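/- A multimatroid is a triple $Q=(U,\Omega,r)$, where $U$ is a finite set, $\Omega$ is a partition of $U$ into non-empty sets called skew classes, and $r$ is a function to the non-negative integers from the set $\mathcal S(\Omega)$ of subtransversals. Here a transversal is a subset of $U$ that meets each skew class in exactly one element, and a subtransversal is a subset of a transversal. Two distinct elements of the same skew class form a skew pair. The function $r$ must satisfy: 1. $r(\emptyset)=0$; 2. $r(A)\le r(A\cup x)\le r(A)+1$ if $A\in\mathcal S(\Omega)$ and $x$ is in a skew class that avoids $A$; 3. $r(A)+r(B)\ge r(A\cup B)+r(A\cap B)$ if $A\cup B\in\mathcal S(\Omega)$; 4. $r(A\cup x)-r(A)+r(A\cup y)-r(A)\ge 1$ if $A\in\mathcal S(\Omega)$ and $\{x,y\}$ is a skew pair in a skew class that avoids $A$. For $A\in\mathcal S(\Omega)$, the minor $Q|A$ is the multimatroid $(U',\Omega',r')$ in which $\Omega'$ is the set of skew classes disjoint from $A$, $U'$ is their union, and $r'(X)=r(X\cup A)-r(A)$ for $X\in\mathcal S(\Omega')$. A minor of $Q$ is a multimatroid equal to $Q|A$ for some $A\in\mathcal S(\Omega)$. Write $Q|x$ for $Q|\{x\}$.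 A separator of $Q$ is a union $X$ of skew classes with $r(A)=r(A\cap X)+r(A-X)$ for all $A\in\mathcal S(\Omega)$. It is proper if $\emptyset\neq X\neq U$. The multimatroid $Q$ is connected if it has no proper separator. It is tight if no skew class has exactly one element and $$\sum_{x\in\omega}\bigl(r(A\cup x)-r(A)\bigr)=|\omega|-1$$ for every skew class $\omega$ and every subtransversal $A$ that avoids $\omega$ and meets every other skew class. **Theorem.** Let $Q$ be a connected tight multimatroid and let $A$ be a non-empty subtransversal such that $Q|A$ is connected. If $e\in A$, then (i) $Q|e$ is connected; or (ii) for all $x$ such that $\{e,x\}$ is a skew pair, $Q|x$ is connected with $Q|A$ as a minor. -/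

import Mathlib

section Partition

variable {α : Type*} [DecidableEq α] {U : Finset α}

/-- `T` is a transversal of the partition `Ω` of `U`: a subset of `U` that meets each skew class
in exactly one element. -/
def IsTransversal (Ω : Finpartition U) (T : Finset α) : Prop :=
  T ⊆ U ∧ ∀ ω ∈ Ω.parts, (T ∩ ω).card = 1

/-- A subtransversal is a set contained in a transversal. -/
def IsSubtransversal (Ω : Finpartition U) (A : Finset α) : Prop :=
  ∃ T, IsTransversal Ω T ∧ A ⊆ T

/-- `{x, y}` is a skew pair: two distinct elements of a common skew class. -/
def IsSkewPair (Ω : Finpartition U) (x y : α) : Prop :=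
  x ≠ y ∧ ∃ ω ∈ Ω.parts, x ∈ ω ∧ y ∈ ω

/-- A near-transversal is a subtransversal that meets all of the skew classes except for one. -/
def IsNearTransversal (Ω : Finpartition U) (A : Finset α) : Prop :=
  IsSubtransversal Ω A ∧ ∃! ω, ω ∈ Ω.parts ∧ Disjoint ω A

/-- The partition consisting of those skew classes that avoid `A`, on the set of their elements. -/
def classesAvoiding (Ω : Finpartition U) (A : Finset α) :
    Finpartition ((Ω.parts.filter fun ω => Disjoint ω A).sup id) :=
  Ω.ofSubset (Finset.filter_subset _ _) rfl

theorem mem_classesAvoiding {Ω : Finpartition U} {A ω : Finset α} :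
    ω ∈ (classesAvoiding Ω A).parts ↔ ω ∈ Ω.parts ∧ Disjoint ω A := by
  simp [classesAvoiding, Finpartition.ofSubset]

theorem isSubtransversal_iff {Ω : Finpartition U} {A : Finset α} :
    IsSubtransversal Ω A ↔ A ⊆ U ∧ ∀ ω ∈ Ω.parts, (A ∩ ω).card ≤ 1 := by
  constructor
  · rintro ⟨T, hT, hA⟩
    exact ⟨hA.trans hT.1, fun ω hω =>
      (Finset.card_le_card (Finset.inter_subset_inter_right hA)).trans (hT.2 ω hω).le⟩
  · rintro ⟨hU, hA⟩
    have key : ∀ ω ∈ Ω.parts, ∃ x, x ∈ ω ∧ A ∩ ω ⊆ {x} := by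
      intro ω hω
      rcases (A ∩ ω).eq_empty_or_nonempty with h | ⟨x, hx⟩
      · obtain ⟨x, hx⟩ := Ω.nonempty_of_mem_parts hω
        exact ⟨x, hx, by simp [h]⟩
      · refine ⟨x, (Finset.mem_inter.1 hx).2, fun y hy => ?_⟩
        rw [Finset.mem_singleton]
        exact Finset.card_le_one.1 (hA ω hω) y hy x hx
    choose f hf hf' using key
    refine ⟨Ω.parts.attach.image fun ω => f ω.1 ω.2, ⟨?_, ?_⟩, ?_⟩
    · intro x hx
      simp only [Finset.mem_image, Finset.mem_attach, true_and, Subtype.exists] at hx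
      obtain ⟨ω, hω, rfl⟩ := hx
      exact Ω.le hω (hf ω hω)
    · intro ω hω
      rw [Finset.card_eq_one]
      refine ⟨f ω hω, ?_⟩
      ext x
      simp only [Finset.mem_inter, Finset.mem_image, Finset.mem_attach, true_and, Subtype.exists,
        Finset.mem_singleton]
      constructor
      · rintro ⟨⟨η, hη, rfl⟩, hx⟩
        obtain rfl := Ω.eq_of_mem_parts hη hω (hf η hη) hx
        rfl
      · rintro rfl
        exact ⟨⟨ω, hω, rfl⟩, hf ω hω⟩
    · intro x hx
      obtain ⟨ω, hω, hxω⟩ := Ω.exists_mem (hU hx)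
      simp only [Finset.mem_image, Finset.mem_attach, true_and, Subtype.exists]
      exact ⟨ω, hω, (Finset.mem_singleton.1 (hf' ω hω (Finset.mem_inter.2 ⟨hx, hxω⟩))).symm⟩

theorem IsSubtransversal.mono {Ω : Finpartition U} {A B : Finset α}
    (hB : IsSubtransversal Ω B) (h : A ⊆ B) : IsSubtransversal Ω A := by
  obtain ⟨T, hT, hBT⟩ := hB
  exact ⟨T, hT, h.trans hBT⟩

theorem IsSubtransversal.singleton_of_mem {Ω : Finpartition U} {A : Finset α} {e : α}
    (hA : IsSubtransversal Ω A) (he : e ∈ A) : IsSubtransversal Ω {e} :=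
  hA.mono (Finset.singleton_subset_iff.2 he)

theorem IsSkewPair.right_singleton {Ω : Finpartition U} {e x : α}
    (h : IsSkewPair Ω e x) : IsSubtransversal Ω {x} := by
  obtain ⟨-, ω, hω, -, hx⟩ := h
  refine isSubtransversal_iff.2 ⟨Finset.singleton_subset_iff.2 (Ω.le hω hx), fun η _ => ?_⟩
  exact (Finset.card_le_card Finset.inter_subset_left).trans (by simp)

/-- Adding an element of a skew class that avoids a subtransversal. -/
theorem IsSubtransversal.insert {Ω : Finpartition U} {A ω : Finset α} {x : α}
    (hA : IsSubtransversal Ω A) (hω : ω ∈ Ω.parts) (hd : Disjoint ω A) (hx : x ∈ ω) :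
    IsSubtransversal Ω (insert x A) := by
  rw [isSubtransversal_iff] at hA ⊢
  refine ⟨Finset.insert_subset (Ω.le hω hx) hA.1, fun η hη => ?_⟩
  by_cases h : x ∈ η
  · obtain rfl := Ω.eq_of_mem_parts hω hη hx h
    rw [Finset.insert_inter_of_mem hx, Finset.inter_comm, Finset.disjoint_iff_inter_eq_empty.1 hd]
    simp
  · rw [Finset.insert_inter_of_notMem h]
    exact hA.2 η hη

/-- A subtransversal of the skew classes avoiding `A`, together with the subtransversal `A`,
forms a subtransversal. -/
theorem IsSubtransversal.union_of_avoiding {Ω : Finpartition U} {A X : Finset α}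
    (hA : IsSubtransversal Ω A) (hX : IsSubtransversal (classesAvoiding Ω A) X) :
    IsSubtransversal Ω (X ∪ A) := by
  rw [isSubtransversal_iff] at hA hX ⊢
  have hXU : ∀ x ∈ X, ∃ ω ∈ Ω.parts, Disjoint ω A ∧ x ∈ ω := by
    intro x hx
    simpa [Finset.mem_sup, and_assoc] using hX.1 hx
  refine ⟨Finset.union_subset (fun x hx => ?_) hA.1, fun ω hω => ?_⟩
  · obtain ⟨ω, hω, -, hxω⟩ := hXU x hx
    exact Ω.le hω hxω
  · rw [Finset.union_inter_distrib_right]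
    by_cases hd : Disjoint ω A
    · rw [Finset.inter_comm A, Finset.disjoint_iff_inter_eq_empty.1 hd, Finset.union_empty]
      exact hX.2 ω (mem_classesAvoiding.2 ⟨hω, hd⟩)
    · have : X ∩ ω = ∅ := by
        rw [Finset.eq_empty_iff_forall_notMem]
        intro x hx
        rw [Finset.mem_inter] at hx
        obtain ⟨η, hη, hηA, hxη⟩ := hXU x hx.1
        obtain rfl := Ω.eq_of_mem_parts hη hω hxη hx.2
        exact hd hηA
      rw [this, Finset.empty_union]
      exact hA.2 ω hω

end Partition

/-- A multimatroid `(U, Ω, r)` with `U` a finite set of elements of `α`. The rank function is a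
function on subtransversals; as a function on all finite sets it is normalized to be `0` on
all other sets, so that two multimatroids are equal exactly when they have the same ground set,
the same skew classes and the same rank of every subtransversal. -/
@[ext]
structure Multimatroid (α : Type*) [DecidableEq α] where
  /-- The ground set `U`. -/
  ground : Finset α
  /-- The partition `Ω` of `U` into skew classes. -/
  classes : Finpartition ground
  /-- The rank function. -/
  r : Finset α → ℕ
  r_of_not_isSubtransversal : ∀ A, ¬ IsSubtransversal classes A → r A = 0
  r_empty : r ∅ = 0
  r_insert : ∀ A, IsSubtransversal classes A → ∀ ω ∈ classes.parts, Disjoint ω A → ∀ x ∈ ω,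
    r A ≤ r (insert x A) ∧ r (insert x A) ≤ r A + 1
  r_submodular : ∀ A B, IsSubtransversal classes (A ∪ B) →
    r (A ∪ B) + r (A ∩ B) ≤ r A + r B
  r_skewPair : ∀ A, IsSubtransversal classes A → ∀ ω ∈ classes.parts, Disjoint ω A →
    ∀ x ∈ ω, ∀ y ∈ ω, x ≠ y →
      1 ≤ ((r (insert x A) : ℤ) - r A) + ((r (insert y A) : ℤ) - r A)

namespace Multimatroid

variable {α : Type*} [DecidableEq α]

/-- The rank function is monotone on subtransversals. -/
theorem r_le_union (Q : Multimatroid α) (A X : Finset α)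
    (h : IsSubtransversal Q.classes (X ∪ A)) : Q.r A ≤ Q.r (X ∪ A) := by
  induction X using Finset.induction_on with
  | empty => simp
  | insert x X hx ih =>
    rw [Finset.insert_union] at h ⊢
    have h' : IsSubtransversal Q.classes (X ∪ A) := h.mono (Finset.subset_insert _ _)
    refine (ih h').trans ?_
    by_cases hxA : x ∈ X ∪ A
    · rw [Finset.insert_eq_of_mem hxA]
    · have hxU := (isSubtransversal_iff.1 h).1 (Finset.mem_insert_self x _)
      obtain ⟨ω, hω, hxω⟩ := Q.classes.exists_mem hxU
      refine (Q.r_insert _ h' ω hω ?_ x hxω).1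
      rw [Finset.disjoint_left]
      intro y hyω hy
      have := Finset.card_le_one.1 ((isSubtransversal_iff.1 h).2 ω hω) y
        (Finset.mem_inter.2 ⟨Finset.mem_insert_of_mem hy, hyω⟩) x
        (Finset.mem_inter.2 ⟨Finset.mem_insert_self x _, hxω⟩)
      exact hxA (this ▸ hy)

open Classical in
/-- The minor `Q|A` of `Q` with respect to a subtransversal `A`: its skew classes are those of `Q`
that avoid `A`, its ground set is the union of these, and the rank of a subtransversal `X` is
`r (X ∪ A) - r A` (a difference that is never negative). -/
noncomputable def minor (Q : Multimatroid α) (A : Finset α)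
    (hA : IsSubtransversal Q.classes A) : Multimatroid α where
  ground := (Q.classes.parts.filter fun ω => Disjoint ω A).sup id
  classes := classesAvoiding Q.classes A
  r X := if IsSubtransversal (classesAvoiding Q.classes A) X then Q.r (X ∪ A) - Q.r A else 0
  r_of_not_isSubtransversal X hX := if_neg hX
  r_empty := by simp
  r_insert X hX ω hω hd x hx := by
    obtain ⟨hω', hωA⟩ := mem_classesAvoiding.1 hω
    have hXA := hA.union_of_avoiding hX
    rw [if_pos hX, if_pos (hX.insert hω hd hx), Finset.insert_union]
    have h1 := Q.r_insert _ hXA ω hω' (Finset.disjoint_union_right.2 ⟨hd, hωA⟩) x hx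
    have h2 := Q.r_le_union A X hXA
    omega
  r_submodular X Y h := by
    have hX := h.mono (Finset.subset_union_left (s₁ := X) (s₂ := Y))
    have hY := h.mono (Finset.subset_union_right (s₁ := X) (s₂ := Y))
    have hXY := h.mono (Finset.inter_subset_union (s := X) (t := Y))
    rw [if_pos h, if_pos hX, if_pos hY, if_pos hXY]
    have h1 := Q.r_submodular (X ∪ A) (Y ∪ A)
      (by rw [← Finset.union_union_distrib_right]; exact hA.union_of_avoiding h)
    rw [← Finset.union_union_distrib_right, ← Finset.inter_union_distrib_right] at h1
    have h2 := Q.r_le_union A _ (hA.union_of_avoiding h)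
    have h3 := Q.r_le_union A _ (hA.union_of_avoiding hX)
    have h4 := Q.r_le_union A _ (hA.union_of_avoiding hY)
    have h5 := Q.r_le_union A _ (hA.union_of_avoiding hXY)
    omega
  r_skewPair X hX ω hω hd x hx y hy hxy := by
    obtain ⟨hω', hωA⟩ := mem_classesAvoiding.1 hω
    have hXA := hA.union_of_avoiding hX
    have hx' := hX.insert hω hd hx
    have hy' := hX.insert hω hd hy
    rw [if_pos hX, if_pos hx', if_pos hy', Finset.insert_union, Finset.insert_union]
    have h1 := Q.r_skewPair _ hXA ω hω' (Finset.disjoint_union_right.2 ⟨hd, hωA⟩) x hx y hy hxy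
    have h2 := Q.r_le_union A _ hXA
    have h3 := Q.r_le_union A _ (hA.union_of_avoiding hx')
    have h4 := Q.r_le_union A _ (hA.union_of_avoiding hy')
    rw [Finset.insert_union] at h3 h4
    omega

/-- `P` is a minor of `Q`: it equals `Q|A` for some subtransversal `A` of `Q`. -/
def IsMinor (P Q : Multimatroid α) : Prop :=
  ∃ (A : Finset α) (hA : IsSubtransversal Q.classes A), P = Q.minor A hA

/-- A separator is a union `X` of skew classes such that `r A = r (A ∩ X) + r (A - X)` for every
subtransversal `A`. -/
def IsSeparator (Q : Multimatroid α) (X : Finset α) : Prop :=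
  (∃ P ⊆ Q.classes.parts, X = P.biUnion id) ∧
    ∀ A, IsSubtransversal Q.classes A → Q.r A = Q.r (A ∩ X) + Q.r (A \ X)

/-- A proper separator is one that is neither empty nor the whole ground set. -/
def IsProperSeparator (Q : Multimatroid α) (X : Finset α) : Prop :=
  Q.IsSeparator X ∧ X.Nonempty ∧ X ≠ Q.ground

/-- A multimatroid is connected if it has no proper separator. -/
def Connected (Q : Multimatroid α) : Prop :=
  ¬ ∃ X, Q.IsProperSeparator X

/-- A multimatroid is non-degenerate if no skew class consists of a single element. -/
def NonDegenerate (Q : Multimatroid α) : Prop :=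
  ∀ ω ∈ Q.classes.parts, ω.card ≠ 1

/-- A multimatroid is tight if it is non-degenerate and, for every skew class `ω` and every
near-transversal `A` that avoids `ω`, the sum of `r (A ∪ x) - r A` over `x ∈ ω` is `|ω| - 1`. -/
def Tight (Q : Multimatroid α) : Prop :=
  Q.NonDegenerate ∧
    ∀ ω ∈ Q.classes.parts, ∀ A, IsNearTransversal Q.classes A → Disjoint ω A →
      ∑ x ∈ ω, ((Q.r (insert x A) : ℤ) - Q.r A) = (ω.card : ℤ) - 1

end Multimatroid

/-!
Let `ω₀` be the skew class of `e`. By tightness, each transversal `T` of the other classes has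
exactly one element `f T` of `ω₀` in its closure. Changing `T` in a single class `ω₁` makes `f`
either constant or a surjection from `ω₁` onto `ω₀` (`Multimatroid.Tight.spans_exchange`). So if
`T` varies in certain classes only and `f` misses some value throughout, `f` is constant there
(`Multimatroid.Tight.spans_of_sdiff_eq`). Everything else rests on this.

If `Q|e` has complementary proper separators `X` and `Y`, then `f T = e` exactly when `T ∩ X` or
`T ∩ Y` spans `e` (`Multimatroid.IsSplit.spans_inter_or`). Both possibilities occur for suitable
transversals: if no `T ∩ X` spans `e`, then `f T` does not depend on the `X`-side of `T` and `X` is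
a separator of `Q` itself (`Multimatroid.IsSplit.exists_spans_inter`).

Suppose now that `Q|x` has separators `X'` and `Y'` as well, for some `x ≠ e` in `ω₀`. Take
transversals `T₁`, `T₂`, `T₃`, `T₄` whose parts in `X`, `Y'`, `Y`, `X'` span `e`, `x`, `e`, `x`,
and write transversals as quadruples along `X ∩ X'`, `X ∩ Y'`, `Y ∩ X'`, `Y ∩ Y'`. Then
`f (T₁, T₁, T₄, T₃) = e` and `f (T₄, T₂, T₄, T₃) = x`. Changing the second entry of the former never
produces `x`, because the last entry belongs to `T₃`; changing the first entry of the latter never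
produces `e`, because the second entry belongs to `T₂`. By constancy `f (T₁, T₂, T₄, T₃)` is both
`e` and `x`, a contradiction (`Multimatroid.IsSplit.eq_of_isSplit`). Hence `Q|x` is connected.

Finally, `Q|A` being connected, `A` meets all classes on one side, say `X`. If `T ∩ X` spans `e`,
then adding `x` to it raises the rank and `Q|(x ∪ (T ∩ X))` agrees with `Q|e` on `Y`, so `Q|A` is
the minor of `Q|x` by `(A ∩ Y) ∪ (T ∩ X)` (`Multimatroid.IsSplit.isMinor`).
-/

/-! ### Subtransversals and transversals of all classes but one -/

section Subtransversal

variable {α : Type*} [DecidableEq α] {U : Finset α} {Ω : Finpartition U}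

theorem isSubtransversal_iff_forall_mem {A : Finset α} :
    IsSubtransversal Ω A ↔
      A ⊆ U ∧ ∀ ω ∈ Ω.parts, ∀ x ∈ A, ∀ y ∈ A, x ∈ ω → y ∈ ω → x = y := by
  rw [isSubtransversal_iff]
  refine and_congr_right fun _ => forall₂_congr fun ω _ => ?_
  rw [Finset.card_le_one]
  simp only [Finset.mem_inter]
  exact ⟨fun h x hx y hy hxω hyω => h x ⟨hx, hxω⟩ y ⟨hy, hyω⟩,
    fun h x hx y hy => h x hx.1 y hy.1 hx.2 hy.2⟩

theorem IsSubtransversal.eq_of_mem {A ω : Finset α} {x y : α} (hA : IsSubtransversal Ω A)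
    (hω : ω ∈ Ω.parts) (hx : x ∈ A) (hy : y ∈ A) (hxω : x ∈ ω) (hyω : y ∈ ω) : x = y :=
  (isSubtransversal_iff_forall_mem.1 hA).2 ω hω x hx y hy hxω hyω

theorem IsSubtransversal.subset {A : Finset α} (hA : IsSubtransversal Ω A) : A ⊆ U :=
  (isSubtransversal_iff.1 hA).1

theorem isSubtransversal_classesAvoiding_iff {A X : Finset α} :
    IsSubtransversal (classesAvoiding Ω A) X ↔
      IsSubtransversal Ω X ∧ ∀ ω ∈ Ω.parts, ¬ Disjoint ω A → Disjoint ω X := by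
  simp only [isSubtransversal_iff_forall_mem, mem_classesAvoiding]
  constructor
  · rintro ⟨hU, h⟩
    have hmem : ∀ x ∈ X, ∃ ω ∈ Ω.parts, Disjoint ω A ∧ x ∈ ω := by
      intro x hx
      simpa [Finset.mem_sup, and_assoc] using hU hx
    refine ⟨⟨fun x hx => ?_, fun ω hω x hx y hy hxω hyω => ?_⟩, fun ω hω hA => ?_⟩
    · obtain ⟨ω, hω, -, hxω⟩ := hmem x hx
      exact Ω.le hω hxω
    · obtain ⟨η, hη, hd, hxη⟩ := hmem x hx
      obtain rfl := Ω.eq_of_mem_parts hη hω hxη hxω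
      exact h η ⟨hη, hd⟩ x hx y hy hxω hyω
    · rw [Finset.disjoint_left]
      intro x hxω hx
      obtain ⟨η, hη, hd, hxη⟩ := hmem x hx
      obtain rfl := Ω.eq_of_mem_parts hη hω hxη hxω
      exact hA hd
  · rintro ⟨⟨hU, h⟩, hd⟩
    refine ⟨fun x hx => ?_, fun ω hω => h ω hω.1⟩
    obtain ⟨ω, hω, hxω⟩ := Ω.exists_mem (hU hx)
    have : Disjoint ω A := by
      by_contra hA
      exact Finset.disjoint_left.1 (hd ω hω hA) hxω hx
    simp only [Finset.mem_sup, Finset.mem_filter, id]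
    exact ⟨ω, ⟨hω, this⟩, hxω⟩

/-- `T` is a transversal of the skew classes other than `ω₀`: a subtransversal that avoids `ω₀`
and no other class. -/
def IsTransversalOff (Ω : Finpartition U) (ω₀ T : Finset α) : Prop :=
  IsSubtransversal Ω T ∧ ∀ ω ∈ Ω.parts, Disjoint ω T ↔ ω = ω₀

variable {ω₀ T T' Z : Finset α}

theorem IsTransversalOff.disjoint (hT : IsTransversalOff Ω ω₀ T) (h₀ : ω₀ ∈ Ω.parts) :
    Disjoint ω₀ T :=
  (hT.2 ω₀ h₀).2 rfl

theorem IsTransversalOff.exists_mem (hT : IsTransversalOff Ω ω₀ T) {ω : Finset α}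
    (hω : ω ∈ Ω.parts) (hne : ω ≠ ω₀) : ∃ x ∈ ω, x ∈ T :=
  Finset.not_disjoint_iff.1 fun h => hne ((hT.2 ω hω).1 h)

theorem IsTransversalOff.isNearTransversal (hT : IsTransversalOff Ω ω₀ T) (h₀ : ω₀ ∈ Ω.parts) :
    IsNearTransversal Ω T :=
  ⟨hT.1, ω₀, ⟨h₀, hT.disjoint h₀⟩, fun ω hω => (hT.2 ω hω.1).1 hω.2⟩

theorem IsTransversalOff.insert (hT : IsTransversalOff Ω ω₀ T) (h₀ : ω₀ ∈ Ω.parts) {y : α}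
    (hy : y ∈ ω₀) : IsSubtransversal Ω (insert y T) :=
  hT.1.insert h₀ (hT.disjoint h₀) hy

/-- Two transversals of the classes other than `ω₀` can be combined along a set `Z` that is,
outside `ω₀`, a union of classes. -/
theorem IsTransversalOff.mix (hT : IsTransversalOff Ω ω₀ T) (hT' : IsTransversalOff Ω ω₀ T')
    (h₀ : ω₀ ∈ Ω.parts) (hZ : ∀ ω ∈ Ω.parts, ω ≠ ω₀ → ω ⊆ Z ∨ Disjoint ω Z) :
    IsTransversalOff Ω ω₀ (T ∩ Z ∪ T' \ Z) := by
  have hd := Finset.disjoint_left.1 (hT.disjoint h₀)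
  have hd' := Finset.disjoint_left.1 (hT'.disjoint h₀)
  refine ⟨isSubtransversal_iff_forall_mem.2 ⟨?_, ?_⟩, fun ω hω => ⟨fun h => ?_, ?_⟩⟩
  · intro x hx
    have h1 : x ∈ T → x ∈ U := fun h => hT.1.subset h
    have h2 : x ∈ T' → x ∈ U := fun h => hT'.1.subset h
    grind
  · intro ω hω x hx y hy hxω hyω
    have h1 := fun a b => hT.1.eq_of_mem (x := x) (y := y) hω a b hxω hyω
    have h2 := fun a b => hT'.1.eq_of_mem (x := x) (y := y) hω a b hxω hyω
    rcases eq_or_ne ω ω₀ with rfl | hne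
    · exact absurd hxω (by have := hd (a := x); have := hd' (a := x); grind)
    · rcases hZ ω hω hne with h | h
      · have := h hxω; have := h hyω; grind
      · have := Finset.disjoint_left.1 h hxω; have := Finset.disjoint_left.1 h hyω; grind
  · by_contra hne
    obtain ⟨x, hx, hxT⟩ := hT.exists_mem hω hne
    obtain ⟨y, hy, hyT⟩ := hT'.exists_mem hω hne
    rw [Finset.disjoint_left] at h
    have hx' := h hx
    have hy' := h hy
    rcases hZ ω hω hne with hs | hs
    · have := hs hx; grind
    · have := Finset.disjoint_left.1 hs hy; grind
  · rintro rfl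
    rw [Finset.disjoint_left]
    intro a ha
    have := hd ha; have := hd' ha; grind

end Subtransversal

namespace Multimatroid

/-! ### Rank and closure -/

variable {α : Type*} [DecidableEq α] {Q : Multimatroid α}

theorem r_mono {A B : Finset α} (hB : IsSubtransversal Q.classes B) (h : A ⊆ B) :
    Q.r A ≤ Q.r B := by
  have := Q.r_le_union A B (by rwa [Finset.union_eq_left.2 h])
  rwa [Finset.union_eq_left.2 h] at this

theorem r_insert_le {A : Finset α} {x : α} (h : IsSubtransversal Q.classes (insert x A)) :
    Q.r (insert x A) ≤ Q.r A + 1 := by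
  by_cases hx : x ∈ A
  · rw [Finset.insert_eq_of_mem hx]; omega
  · obtain ⟨ω, hω, hxω⟩ := Q.classes.exists_mem (h.subset (Finset.mem_insert_self x A))
    refine (Q.r_insert A (h.mono (Finset.subset_insert _ _)) ω hω ?_ x hxω).2
    rw [Finset.disjoint_left]
    intro y hy hyA
    exact hx (h.eq_of_mem hω (Finset.mem_insert_of_mem hyA) (Finset.mem_insert_self x A) hy hxω
      ▸ hyA)

theorem r_le_card {A : Finset α} (h : IsSubtransversal Q.classes A) : Q.r A ≤ A.card := by
  induction A using Finset.induction_on with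
  | empty => simp [Q.r_empty]
  | insert x A hx ih =>
    rw [Finset.card_insert_of_notMem hx]
    exact (r_insert_le h).trans (Nat.succ_le_succ (ih (h.mono (Finset.subset_insert _ _))))

/-- `y` lies in the closure of `A`. This is meaningful only when `A ∪ {y}` is a subtransversal,
since the rank of any other set is normalized to `0`. -/
def Spans (Q : Multimatroid α) (A : Finset α) (y : α) : Prop :=
  Q.r (insert y A) = Q.r A

theorem Spans.mono {A B : Finset α} {y : α} (h : Q.Spans A y) (hAB : A ⊆ B)
    (hB : IsSubtransversal Q.classes (insert y B)) : Q.Spans B y := by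
  unfold Spans at *
  by_cases hy : y ∈ B
  · rw [Finset.insert_eq_of_mem hy]
  · have e1 : B ∪ insert y A = insert y B := by grind
    have e2 : B ∩ insert y A = A := by grind
    have := Q.r_submodular B (insert y A) (by rwa [e1])
    rw [e1, e2] at this
    have := r_mono hB (Finset.subset_insert y B)
    omega

theorem r_insert_of_not_spans {A : Finset α} {y : α}
    (hA : IsSubtransversal Q.classes (insert y A)) (h : ¬ Q.Spans A y) :
    Q.r (insert y A) = Q.r A + 1 := by
  have h1 := r_insert_le hA
  have h2 := r_mono hA (Finset.subset_insert y A)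
  unfold Spans at h
  omega

/-- The closure of a subtransversal contains at most one element of a class that it avoids. -/
theorem Spans.unique {A ω : Finset α} {x y : α} (hx : Q.Spans A x) (hy : Q.Spans A y)
    (hA : IsSubtransversal Q.classes A) (hω : ω ∈ Q.classes.parts) (hd : Disjoint ω A)
    (hxω : x ∈ ω) (hyω : y ∈ ω) : x = y := by
  by_contra hne
  have := Q.r_skewPair A hA ω hω hd x hxω y hyω hne
  unfold Spans at hx hy
  omega

/-- In a tight multimatroid the closure of a transversal of the classes other than `ω` contains an
element of `ω`. -/
theorem Tight.exists_spans (hQ : Q.Tight) {ω T : Finset α} (hω : ω ∈ Q.classes.parts)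
    (hT : IsTransversalOff Q.classes ω T) : ∃ y ∈ ω, Q.Spans T y := by
  by_contra! hno
  have h := hQ.2 ω hω T (hT.isNearTransversal hω) (hT.disjoint hω)
  rw [Finset.sum_congr rfl (g := fun _ => (1 : ℤ))] at h
  · rw [Finset.sum_const, nsmul_eq_mul, mul_one] at h
    omega
  · intro x hx
    rw [r_insert_of_not_spans (hT.insert hω hx) (hno x hx)]
    push_cast
    ring

/-- Any subtransversal of a non-degenerate multimatroid extends to a transversal in such a way that
each new element raises the rank. -/
theorem NonDegenerate.exists_extension (hQ : Q.NonDegenerate) {A : Finset α}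
    (hA : IsSubtransversal Q.classes A) :
    ∃ T, IsSubtransversal Q.classes T ∧ A ⊆ T ∧ (∀ ω ∈ Q.classes.parts, ¬ Disjoint ω T) ∧
      Q.r T = Q.r A + (T \ A).card := by
  induction hn : Q.ground.card - A.card using Nat.strong_induction_on generalizing A with
  | _ n ih =>
  by_cases hall : ∀ ω ∈ Q.classes.parts, ¬ Disjoint ω A
  · exact ⟨A, hA, subset_rfl, hall, by simp⟩
  push Not at hall
  obtain ⟨ω, hω, hd⟩ := hall
  have hcard : 1 < ω.card := by
    have h1 := Finset.card_pos.2 (Q.classes.nonempty_of_mem_parts hω)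
    have h2 := hQ ω hω
    omega
  obtain ⟨x, hx, y, hy, hxy⟩ := Finset.one_lt_card.1 hcard
  obtain ⟨z, hz, hzA⟩ : ∃ z ∈ ω, ¬ Q.Spans A z := by
    by_contra! h
    exact hxy ((h x hx).unique (h y hy) hA hω hd hx hy)
  have hz' : z ∉ A := Finset.disjoint_left.1 hd hz
  have hins := hA.insert hω hd hz
  have hc := Finset.card_insert_of_notMem hz'
  have hle := Finset.card_le_card hins.subset
  obtain ⟨T, hT, hsub, hmeet, hr⟩ := ih _ (by omega) hins rfl
  refine ⟨T, hT, (Finset.subset_insert _ _).trans hsub, hmeet, ?_⟩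
  rw [hr, r_insert_of_not_spans hins hzA]
  have h1 := Finset.card_sdiff_of_subset hsub
  have h2 := Finset.card_sdiff_of_subset ((Finset.subset_insert z A).trans hsub)
  have h3 := Finset.card_le_card hsub
  omega

theorem r_le_inter_add_sdiff {A : Finset α} (X : Finset α) (hA : IsSubtransversal Q.classes A) :
    Q.r A ≤ Q.r (A ∩ X) + Q.r (A \ X) := by
  have e1 : A ∩ X ∪ A \ X = A := by grind
  have e2 : A ∩ X ∩ (A \ X) = ∅ := by grind
  have := Q.r_submodular (A ∩ X) (A \ X) (by rwa [e1])
  rw [e1, e2, Q.r_empty] at this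
  omega

/-- A separation of the rank of a subtransversal is inherited by its subsets. -/
theorem r_eq_inter_add_sdiff_of_subset {A T X : Finset α} (hT : IsSubtransversal Q.classes T)
    (hAT : A ⊆ T) (h : Q.r (T ∩ X) + Q.r (T \ X) ≤ Q.r T) :
    Q.r A = Q.r (A ∩ X) + Q.r (A \ X) := by
  refine le_antisymm (r_le_inter_add_sdiff X (hT.mono hAT)) ?_
  have e1 : A ∩ (T ∩ X) = A ∩ X := by grind
  have e2 : (A ∪ T ∩ X) ∪ T \ X = T := by grind
  have e3 : (A ∪ T ∩ X) ∩ (T \ X) = A \ X := by grind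
  have h1 := Q.r_submodular A (T ∩ X) (hT.mono (by grind))
  have h2 := Q.r_submodular (A ∪ T ∩ X) (T \ X) (by rwa [e2])
  rw [e1] at h1
  rw [e2, e3] at h2
  omega

/-! ### Constancy of the spanned element -/

/-- As `u` runs through a class `ω₁`, the unique element of `ω₀` in the closure of `S ∪ {u}` is
constant as soon as it misses some `z ∈ ω₀`. -/
theorem Tight.spans_exchange (hQ : Q.Tight) {ω₀ ω₁ S : Finset α} (h₀ : ω₀ ∈ Q.classes.parts)
    (h₁ : ω₁ ∈ Q.classes.parts) (hne : ω₁ ≠ ω₀) (hS : IsSubtransversal Q.classes S)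
    (hd : ∀ ω ∈ Q.classes.parts, Disjoint ω S ↔ ω = ω₀ ∨ ω = ω₁) {p q y z : α}
    (hp : p ∈ ω₁) (hq : q ∈ ω₁) (hy : y ∈ ω₀) (hz : z ∈ ω₀)
    (hmiss : ∀ u ∈ ω₁, ¬ Q.Spans (insert u S) z) (hpy : Q.Spans (insert p S) y) :
    Q.Spans (insert q S) y := by
  have hdisj : ∀ {a b : α}, a ∈ ω₀ → b ∈ ω₁ → a ≠ b := by
    rintro a b ha hb rfl
    exact hne (Q.classes.eq_of_mem_parts h₁ h₀ hb ha)
  have hoff₀ : ∀ u ∈ ω₁, IsTransversalOff Q.classes ω₀ (insert u S) := by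
    refine fun u hu => ⟨hS.insert h₁ ((hd ω₁ h₁).2 (.inr rfl)) hu, fun ω hω => ?_⟩
    rw [Finset.disjoint_insert_right, hd ω hω]
    refine ⟨fun ⟨h, h'⟩ => h'.resolve_right fun h' => h (h' ▸ hu), ?_⟩
    rintro rfl
    exact ⟨fun h => hdisj h hu rfl, .inl rfl⟩
  have hoff₁ : IsTransversalOff Q.classes ω₁ (insert z S) := by
    refine ⟨hS.insert h₀ ((hd ω₀ h₀).2 (.inl rfl)) hz, fun ω hω => ?_⟩
    rw [Finset.disjoint_insert_right, hd ω hω]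
    refine ⟨fun ⟨h, h'⟩ => h'.resolve_left fun h' => h (h' ▸ hz), ?_⟩
    rintro rfl
    exact ⟨fun h => hdisj hz h rfl, .inr rfl⟩
  -- The element `u ∈ ω₁` spanned by `S ∪ {z}` is spanned by `S`, because `S ∪ {u}` misses `z`.
  obtain ⟨u, hu, huz⟩ := hQ.exists_spans h₁ hoff₁
  have hSu : Q.r (insert u S) = Q.r S := by
    have h1 := r_insert_of_not_spans ((hoff₀ u hu).insert h₀ hz) (hmiss u hu)
    have h2 := r_insert_le hoff₁.1
    have h3 := r_mono (hoff₀ u hu).1 (Finset.subset_insert u S)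
    unfold Spans at huz
    rw [Finset.insert_comm] at huz
    omega
  -- Hence the element of `ω₀` spanned by `S ∪ {u}` is spanned by `S`.
  obtain ⟨v, hv, huv⟩ := hQ.exists_spans h₀ (hoff₀ u hu)
  have hSv : Q.Spans S v := by
    have h1 := r_mono ((hoff₀ u hu).insert h₀ hv)
      (Finset.insert_subset_insert v (Finset.subset_insert u S))
    have h2 := r_mono (hS.insert h₀ ((hd ω₀ h₀).2 (.inl rfl)) hv) (Finset.subset_insert v S)
    unfold Spans at huv ⊢
    omega
  have key : ∀ w ∈ ω₁, Q.Spans (insert w S) v := fun w hw =>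
    hSv.mono (Finset.subset_insert w S) ((hoff₀ w hw).insert h₀ hv)
  obtain rfl := (key p hp).unique hpy (hoff₀ p hp).1 h₀ ((hoff₀ p hp).disjoint h₀) hv hy
  exact key q hq

/-- The element of `ω₀` in the closure of a transversal `T` of the other classes is constant while
`T` varies inside `Z` only, as soon as it misses some `z ∈ ω₀`. -/
theorem Tight.spans_of_sdiff_eq (hQ : Q.Tight) {ω₀ T T' Z : Finset α}
    (h₀ : ω₀ ∈ Q.classes.parts) (hZ : ∀ ω ∈ Q.classes.parts, ω ≠ ω₀ → ω ⊆ Z ∨ Disjoint ω Z)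
    (hT : IsTransversalOff Q.classes ω₀ T) (hT' : IsTransversalOff Q.classes ω₀ T')
    (hTT' : T' \ Z = T \ Z) {y z : α} (hy : y ∈ ω₀) (hz : z ∈ ω₀)
    (hmiss : ∀ R, IsTransversalOff Q.classes ω₀ R → R \ Z = T \ Z → ¬ Q.Spans R z)
    (hspan : Q.Spans T y) : Q.Spans T' y := by
  induction hn : (T' \ T).card using Nat.strong_induction_on generalizing T with
  | _ n ih =>
  by_cases hsub : T' ⊆ T
  · have : T' = T := by
      refine hsub.antisymm fun x hx => ?_
      obtain ⟨ω, hω, hxω⟩ := Q.classes.exists_mem (hT.1.subset hx)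
      have hne : ω ≠ ω₀ := by
        rintro rfl
        exact Finset.disjoint_left.1 (hT.disjoint hω) hxω hx
      obtain ⟨y, hyω, hyT'⟩ := hT'.exists_mem hω hne
      rwa [hT.1.eq_of_mem hω hx (hsub hyT') hxω hyω]
    rwa [this]
  obtain ⟨q, hqT', hqT⟩ := Finset.not_subset.1 hsub
  obtain ⟨ω, hω, hqω⟩ := Q.classes.exists_mem (hT'.1.subset hqT')
  have hne : ω ≠ ω₀ := by
    rintro rfl
    exact Finset.disjoint_left.1 (hT'.disjoint hω) hqω hqT'
  have hqZ : q ∈ Z := by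
    by_contra h
    have : q ∈ T \ Z := hTT' ▸ Finset.mem_sdiff.2 ⟨hqT', h⟩
    exact hqT (Finset.mem_sdiff.1 this).1
  have hωZ : ω ⊆ Z := (hZ ω hω hne).resolve_right fun h => Finset.disjoint_left.1 h hqω hqZ
  obtain ⟨p, hpω, hpT⟩ := hT.exists_mem hω hne
  have hins : insert p (T.erase p) = T := Finset.insert_erase hpT
  have hS : IsSubtransversal Q.classes (T.erase p) := hT.1.mono (Finset.erase_subset _ _)
  have hSd : ∀ η ∈ Q.classes.parts, Disjoint η (T.erase p) ↔ η = ω₀ ∨ η = ω := by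
    intro η hη
    rw [← hT.2 η hη]
    constructor
    · intro h
      by_cases hpη : p ∈ η
      · exact .inr (Q.classes.eq_of_mem_parts hη hω hpη hpω)
      · left
        rw [← hins, Finset.disjoint_insert_right]
        exact ⟨hpη, h⟩
    · rintro (h | rfl)
      · exact h.mono_right (Finset.erase_subset _ _)
      · rw [Finset.disjoint_left]
        intro a ha haT
        exact (Finset.mem_erase.1 haT).1
          (hT.1.eq_of_mem hη (Finset.mem_erase.1 haT).2 hpT ha hpω)
  have hoff : ∀ u ∈ ω, IsTransversalOff Q.classes ω₀ (insert u (T.erase p)) := by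
    refine fun u hu => ⟨hS.insert hω ((hSd ω hω).2 (.inr rfl)) hu, fun η hη => ?_⟩
    rw [Finset.disjoint_insert_right, hSd η hη]
    refine ⟨fun ⟨h, h'⟩ => h'.resolve_right fun h' => h (h' ▸ hu), ?_⟩
    rintro rfl
    exact ⟨fun h => hne (Q.classes.eq_of_mem_parts hω hη hu h), .inl rfl⟩
  have hoffZ : ∀ u ∈ ω, insert u (T.erase p) \ Z = T \ Z := by
    intro u hu
    rw [Finset.insert_sdiff_of_mem _ (hωZ hu), ← Finset.insert_sdiff_of_mem _ (hωZ hpω), hins]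
  refine ih _ ?_ (hoff q hqω) (by rw [hTT', hoffZ q hqω]) ?_ ?_ rfl
  · rw [← hn]
    apply Finset.card_lt_card
    rw [Finset.ssubset_iff_of_subset]
    · exact ⟨q, by grind, by grind⟩
    · intro a ha
      have : a ∈ T' → a = p → q = p := by
        rintro haT' rfl
        exact hT'.1.eq_of_mem hω hqT' haT' hqω hpω
      grind
  · intro R hR hRZ
    exact hmiss R hR (by rw [hRZ, hoffZ q hqω])
  · exact hQ.spans_exchange h₀ hω hne hS hSd hpω hqω hy hz
      (fun u hu => hmiss _ (hoff u hu) (hoffZ u hu)) (by rwa [hins])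

/-! ### Separations of the minor by one element -/

theorem minor_r_add {A K : Finset α} (hA : IsSubtransversal Q.classes A)
    (hK : IsSubtransversal (classesAvoiding Q.classes A) K) :
    (Q.minor A hA).r K + Q.r A = Q.r (K ∪ A) := by
  have := Q.r_le_union A K (hA.union_of_avoiding hK)
  simp only [minor, if_pos hK]
  omega

theorem mem_minor_ground {A : Finset α} (hA : IsSubtransversal Q.classes A) {a : α} :
    a ∈ (Q.minor A hA).ground ↔ ∃ ω ∈ Q.classes.parts, Disjoint ω A ∧ a ∈ ω := by
  simp [minor, Finset.mem_sup, and_assoc]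

theorem isTransversalOff_erase {ω₀ T : Finset α} {y : α} (hT : IsSubtransversal Q.classes T)
    (hmeet : ∀ ω ∈ Q.classes.parts, ¬ Disjoint ω T) (h₀ : ω₀ ∈ Q.classes.parts) (hyT : y ∈ T)
    (hy : y ∈ ω₀) : IsTransversalOff Q.classes ω₀ (T.erase y) := by
  refine ⟨hT.mono (Finset.erase_subset _ _), fun ω hω => ⟨fun h => ?_, ?_⟩⟩
  · obtain ⟨x, hx, hxT⟩ := Finset.not_disjoint_iff.1 (hmeet ω hω)
    by_cases hxy : x = y
    · exact Q.classes.eq_of_mem_parts hω h₀ (hxy ▸ hx) hy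
    · exact absurd (Finset.mem_erase.2 ⟨hxy, hxT⟩) (Finset.disjoint_left.1 h hx)
  · rintro rfl
    rw [Finset.disjoint_left]
    intro a ha haT
    exact (Finset.mem_erase.1 haT).1 (hT.eq_of_mem hω (Finset.mem_erase.1 haT).2 hyT ha hy)

/-- The sets `X` and `Y` are complementary proper separators of `Q|e`, where `ω₀` is the class
of `e`, expressed through the rank function of `Q`. -/
structure IsSplit (Q : Multimatroid α) (ω₀ : Finset α) (e : α) (X Y : Finset α) : Prop where
  left_nonempty : X.Nonempty
  right_nonempty : Y.Nonempty
  left_subset : X ⊆ Q.ground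
  right_subset : Y ⊆ Q.ground
  disjoint : Disjoint X Y
  disjoint_left : Disjoint ω₀ X
  disjoint_right : Disjoint ω₀ Y
  subset_or_subset : ∀ ω ∈ Q.classes.parts, ω ≠ ω₀ → ω ⊆ X ∨ ω ⊆ Y
  rank : ∀ T, IsSubtransversal Q.classes T → e ∈ T →
    Q.r T + Q.r {e} = Q.r (insert e (T ∩ X)) + Q.r (insert e (T ∩ Y))

namespace IsSplit

variable {ω₀ X Y T R : Finset α} {e : α}

theorem symm (h : Q.IsSplit ω₀ e X Y) : Q.IsSplit ω₀ e Y X where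
  left_nonempty := h.right_nonempty
  right_nonempty := h.left_nonempty
  left_subset := h.right_subset
  right_subset := h.left_subset
  disjoint := h.disjoint.symm
  disjoint_left := h.disjoint_right
  disjoint_right := h.disjoint_left
  subset_or_subset ω hω hne := (h.subset_or_subset ω hω hne).symm
  rank T hT he := by rw [h.rank T hT he, add_comm]

theorem subset_or_disjoint (h : Q.IsSplit ω₀ e X Y) :
    ∀ ω ∈ Q.classes.parts, ω ≠ ω₀ → ω ⊆ X ∨ Disjoint ω X := fun ω hω hne =>
  (h.subset_or_subset ω hω hne).imp_right fun hs => h.disjoint.symm.mono_left hs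

theorem ne_of_mem (h : Q.IsSplit ω₀ e X Y) {ω : Finset α} {x : α} (hx : x ∈ ω) (hxX : x ∈ X) :
    ω ≠ ω₀ := by
  rintro rfl
  exact Finset.disjoint_left.1 h.disjoint_left hx hxX

theorem mem_or_mem (h : Q.IsSplit ω₀ e X Y) (h₀ : ω₀ ∈ Q.classes.parts)
    (hT : IsTransversalOff Q.classes ω₀ T) {x : α} (hx : x ∈ T) : x ∈ X ∨ x ∈ Y := by
  obtain ⟨ω, hω, hxω⟩ := Q.classes.exists_mem (hT.1.subset hx)
  refine (h.subset_or_subset ω hω ?_).imp (fun hs => hs hxω) (fun hs => hs hxω)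
  rintro rfl
  exact Finset.disjoint_left.1 (hT.disjoint h₀) hxω hx

theorem sdiff_eq (h : Q.IsSplit ω₀ e X Y) (h₀ : ω₀ ∈ Q.classes.parts)
    (hT : IsTransversalOff Q.classes ω₀ T) : T \ X = T ∩ Y := by
  ext x
  have h1 := h.mem_or_mem h₀ hT (x := x)
  have h2 : x ∈ X → x ∉ Y := fun hx => Finset.disjoint_left.1 h.disjoint hx
  simp only [Finset.mem_sdiff, Finset.mem_inter]
  tauto

theorem rank_insert (h : Q.IsSplit ω₀ e X Y) (h₀ : ω₀ ∈ Q.classes.parts) (he : e ∈ ω₀)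
    (hT : IsTransversalOff Q.classes ω₀ T) :
    Q.r (insert e T) + Q.r {e} = Q.r (insert e (T ∩ X)) + Q.r (insert e (T ∩ Y)) := by
  have := h.rank (insert e T) (hT.insert h₀ he) (Finset.mem_insert_self _ _)
  rwa [Finset.insert_inter_of_notMem (Finset.disjoint_left.1 h.disjoint_left he),
    Finset.insert_inter_of_notMem (Finset.disjoint_left.1 h.disjoint_right he)] at this

theorem spans_of_spans_inter (h₀ : ω₀ ∈ Q.classes.parts) (he : e ∈ ω₀)
    (hT : IsTransversalOff Q.classes ω₀ T) (hs : Q.Spans (T ∩ X) e) : Q.Spans T e :=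
  hs.mono Finset.inter_subset_left (hT.insert h₀ he)

/-- If `X` and `Y` separate `Q|e`, then a transversal of the classes other than that of `e` spans
`e` only if one of its two sides already does. -/
theorem spans_inter_or (h : Q.IsSplit ω₀ e X Y) (h₀ : ω₀ ∈ Q.classes.parts) (he : e ∈ ω₀)
    (hT : IsTransversalOff Q.classes ω₀ T) (hs : Q.Spans T e) :
    Q.Spans (T ∩ X) e ∨ Q.Spans (T ∩ Y) e := by
  by_contra! hno
  have hins := hT.insert h₀ he
  have h1 := r_insert_of_not_spans (hins.mono (Finset.insert_subset_insert e
    Finset.inter_subset_left)) hno.1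
  have h2 := r_insert_of_not_spans (hins.mono (Finset.insert_subset_insert e
    Finset.inter_subset_left)) hno.2
  have h3 := h.rank_insert h₀ he hT
  have h4 := r_le_inter_add_sdiff X hT.1
  have h5 : Q.r {e} ≤ 1 := r_le_card (hins.mono (by simp))
  rw [h.sdiff_eq h₀ hT] at h4
  unfold Spans at hs
  omega

/-- If no transversal spans `e` from within `X`, then `X` also separates the transversals
of `Q`. -/
theorem rank_of_forall_not_spans (h : Q.IsSplit ω₀ e X Y) (htight : Q.Tight)
    (h₀ : ω₀ ∈ Q.classes.parts) (he : e ∈ ω₀)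
    (hno : ∀ T, IsTransversalOff Q.classes ω₀ T → ¬ Q.Spans (T ∩ X) e)
    (hT : IsTransversalOff Q.classes ω₀ T) {y : α} (hy : y ∈ ω₀) :
    Q.r (T ∩ X) + Q.r (insert y (T ∩ Y)) ≤ Q.r (insert y T) := by
  have hdT := hT.disjoint h₀
  have hinse := hT.insert h₀ he
  have hinsy := hT.insert h₀ hy
  have hsubX := Finset.insert_subset_insert e (Finset.inter_subset_left (s₁ := T) (s₂ := X))
  have hsubY := Finset.insert_subset_insert e (Finset.inter_subset_left (s₁ := T) (s₂ := Y))
  have hsubY' := Finset.insert_subset_insert y (Finset.inter_subset_left (s₁ := T) (s₂ := Y))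
  have h1 := h.rank_insert h₀ he hT
  have h2 := r_insert_of_not_spans (hinse.mono hsubX) (hno T hT)
  have h3 : Q.r {e} ≤ 1 := r_le_card (hinse.mono (by simp))
  have h4 := r_insert_le (hinsy.mono hsubY')
  have h5 := r_mono (hinse.mono hsubY) (Finset.subset_insert e (T ∩ Y))
  by_cases hTe : Q.Spans T e
  · by_cases hye : y = e
    · subst hye
      omega
    have h6 := r_insert_of_not_spans hinsy fun hTy =>
      hye (hTy.unique hTe hT.1 h₀ hdT hy he)
    unfold Spans at hTe
    omega
  have hTYe : ¬ Q.Spans (T ∩ Y) e := fun hs => hTe (spans_of_spans_inter h₀ he hT hs)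
  have h6 := r_insert_of_not_spans hinse hTe
  have h7 := r_insert_of_not_spans (hinse.mono hsubY) hTYe
  by_cases hTy : Q.Spans T y
  swap
  · have h8 := r_insert_of_not_spans hinsy hTy
    omega
  -- It remains to see that `T ∩ Y` spans `y`. A transversal `R` with the same `Y`-side still
  -- spans `y`; choose its `X`-side so that every element raises the rank over `y` and `T ∩ Y`.
  obtain ⟨R', hR', hsub, hmeet, hr⟩ := htight.1.exists_extension (hinsy.mono hsubY')
  have hyR' : y ∈ R' := hsub (Finset.mem_insert_self _ _)
  have hR := isTransversalOff_erase hR' hmeet h₀ hyR' hy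
  have hyX : y ∉ X := Finset.disjoint_left.1 h.disjoint_left hy
  have hyY : y ∉ Y := Finset.disjoint_left.1 h.disjoint_right hy
  have hRY : R'.erase y ∩ Y = T ∩ Y := by
    ext x
    simp only [Finset.mem_inter, Finset.mem_erase]
    constructor
    · rintro ⟨⟨-, hxR⟩, hxY⟩
      obtain ⟨ω, hω, hxω⟩ := Q.classes.exists_mem (hR'.subset hxR)
      have hne := h.symm.ne_of_mem hxω hxY
      obtain ⟨z, hzω, hzT⟩ := hT.exists_mem hω hne
      have hzY : z ∈ Y := (h.subset_or_subset ω hω hne).elim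
        (fun hs => absurd hxY (Finset.disjoint_left.1 h.disjoint (hs hxω))) fun hs => hs hzω
      have := hR'.eq_of_mem hω hxR (hsub (Finset.mem_insert_of_mem
        (Finset.mem_inter.2 ⟨hzT, hzY⟩))) hxω hzω
      exact ⟨this ▸ hzT, hxY⟩
    · rintro ⟨hxT, hxY⟩
      refine ⟨⟨?_, hsub (Finset.mem_insert_of_mem (Finset.mem_inter.2 ⟨hxT, hxY⟩))⟩, hxY⟩
      rintro rfl
      exact hyY hxY
  have hspan : Q.Spans (R'.erase y) y := by
    refine htight.spans_of_sdiff_eq h₀ h.subset_or_disjoint hT hR ?_ hy he ?_ hTy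
    · rw [h.sdiff_eq h₀ hT, h.sdiff_eq h₀ hR, hRY]
    · intro R₁ hR₁ hR₁T hs
      rw [h.sdiff_eq h₀ hT, h.sdiff_eq h₀ hR₁] at hR₁T
      rcases h.spans_inter_or h₀ he hR₁ hs with hs' | hs'
      · exact hno R₁ hR₁ hs'
      · exact hTYe (hR₁T ▸ hs')
  have hcard : R' \ insert y (T ∩ Y) = R'.erase y ∩ X := by
    ext x
    have h9 := h.mem_or_mem h₀ hR (x := x)
    have h10 : x ∈ X → x ∉ Y := fun hx => Finset.disjoint_left.1 h.disjoint hx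
    rw [← hRY]
    simp only [Finset.mem_sdiff, Finset.mem_insert, Finset.mem_inter, Finset.mem_erase] at h9 ⊢
    tauto
  have h8 := r_le_inter_add_sdiff X hR.1
  have h9 := r_le_card (hR.1.mono (Finset.inter_subset_left (s₂ := X)))
  rw [h.sdiff_eq h₀ hR, hRY] at h8
  rw [hcard] at hr
  unfold Spans at hspan hTy
  rw [Finset.insert_erase hyR'] at hspan
  omega

/-- In a connected tight multimatroid, each side of a separation of `Q|e` spans `e` for a
suitable transversal. -/
theorem exists_spans_inter (h : Q.IsSplit ω₀ e X Y) (hconn : Q.Connected) (htight : Q.Tight)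
    (h₀ : ω₀ ∈ Q.classes.parts) (he : e ∈ ω₀) :
    ∃ T, IsTransversalOff Q.classes ω₀ T ∧ Q.Spans (T ∩ X) e := by
  by_contra! hno
  refine hconn ⟨X, ⟨⟨Q.classes.parts.filter (· ⊆ X), Finset.filter_subset _ _, ?_⟩, ?_⟩,
    h.left_nonempty, ?_⟩
  · ext x
    simp only [Finset.mem_biUnion, Finset.mem_filter, id]
    refine ⟨fun hx => ?_, fun ⟨ω, hω, hxω⟩ => hω.2 hxω⟩
    obtain ⟨ω, hω, hxω⟩ := Q.classes.exists_mem (h.left_subset hx)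
    refine ⟨ω, ⟨hω, (h.subset_or_disjoint ω hω (h.ne_of_mem hxω hx)).resolve_right
      fun hd => Finset.disjoint_left.1 hd hxω hx⟩, hxω⟩
  · rintro A ⟨T, hT, hAT⟩
    have hTsub : IsSubtransversal Q.classes T := ⟨T, hT, subset_rfl⟩
    have hmeet : ∀ ω ∈ Q.classes.parts, ¬ Disjoint ω T := by
      intro ω hω hd
      have := hT.2 ω hω
      rw [Finset.inter_comm, Finset.disjoint_iff_inter_eq_empty.1 hd] at this
      simp at this
    obtain ⟨y, hy, hyT⟩ := Finset.not_disjoint_iff.1 (hmeet ω₀ h₀)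
    have hoff := isTransversalOff_erase hTsub hmeet h₀ hyT hy
    have key := h.rank_of_forall_not_spans htight h₀ he hno hoff hy
    have hyX : y ∉ X := Finset.disjoint_left.1 h.disjoint_left hy
    have e1 : T.erase y ∩ X = T ∩ X := by
      rw [Finset.erase_inter, Finset.erase_eq_of_notMem (by simp [hyX])]
    have e2 : insert y (T.erase y ∩ Y) = T \ X := by
      rw [← h.sdiff_eq h₀ hoff, ← Finset.insert_sdiff_of_notMem _ hyX, Finset.insert_erase hyT]
    rw [e1, e2, Finset.insert_erase hyT] at key
    exact r_eq_inter_add_sdiff_of_subset hTsub hAT key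
  · rintro rfl
    obtain ⟨y, hy⟩ := h.right_nonempty
    exact Finset.disjoint_right.1 h.disjoint hy (h.right_subset hy)

/-! ### At most one element of a class gives a disconnected minor -/

/-- Distinct elements `e` and `x` of a class cannot both give disconnected minors. -/
theorem eq_of_isSplit {X' Y' : Finset α} {x : α} (h : Q.IsSplit ω₀ e X Y)
    (h' : Q.IsSplit ω₀ x X' Y') (hconn : Q.Connected) (htight : Q.Tight)
    (h₀ : ω₀ ∈ Q.classes.parts) (he : e ∈ ω₀) (hx : x ∈ ω₀) : e = x := by
  by_contra hex
  have hnot : ∀ {T}, IsTransversalOff Q.classes ω₀ T → Q.Spans T e → ¬ Q.Spans T x :=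
    fun hT hTe hTx => hex (hTe.unique hTx hT.1 h₀ (hT.disjoint h₀) he hx)
  obtain ⟨T₁, hT₁, hs₁⟩ := h.exists_spans_inter hconn htight h₀ he
  obtain ⟨T₂, hT₂, hs₂⟩ := h'.symm.exists_spans_inter hconn htight h₀ hx
  obtain ⟨T₃, hT₃, hs₃⟩ := h.symm.exists_spans_inter hconn htight h₀ he
  obtain ⟨T₄, hT₄, hs₄⟩ := h'.exists_spans_inter hconn htight h₀ hx
  have hX := h.subset_or_disjoint
  have hX' := h'.subset_or_disjoint
  have hY := h.symm.subset_or_disjoint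
  have hY' := h'.symm.subset_or_disjoint
  have inter : ∀ {A B : Finset α},
      (∀ ω ∈ Q.classes.parts, ω ≠ ω₀ → ω ⊆ A ∨ Disjoint ω A) →
      (∀ ω ∈ Q.classes.parts, ω ≠ ω₀ → ω ⊆ B ∨ Disjoint ω B) →
      ∀ ω ∈ Q.classes.parts, ω ≠ ω₀ → ω ⊆ A ∩ B ∨ Disjoint ω (A ∩ B) := by
    intro A B hA hB ω hω hne
    rcases hA ω hω hne with hA | hA
    · rcases hB ω hω hne with hB | hB
      · exact .inl (Finset.subset_inter hA hB)
      · exact .inr (hB.mono_right Finset.inter_subset_right)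
    · exact .inr (hA.mono_right Finset.inter_subset_left)
  have hdXY : ∀ {a}, a ∈ X → a ∉ Y := fun ha => Finset.disjoint_left.1 h.disjoint ha
  have hdXY' : ∀ {a}, a ∈ X' → a ∉ Y' := fun ha => Finset.disjoint_left.1 h'.disjoint ha
  -- On the cells `X ∩ X'`, `X ∩ Y'`, `Y ∩ X'`, `Y ∩ Y'` these three transversals agree with
  -- `T₁ T₁ T₄ T₃`, `T₄ T₂ T₄ T₃` and `T₁ T₂ T₄ T₃`, respectively.
  have hA := hT₁.mix (hT₄.mix hT₃ h₀ hX') h₀ hX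
  have hB := hT₄.mix (hT₂.mix hT₃ h₀ hX) h₀ hX'
  set A := T₁ ∩ X ∪ (T₄ ∩ X' ∪ T₃ \ X') \ X with hAdef
  set B := T₄ ∩ X' ∪ (T₂ ∩ X ∪ T₃ \ X) \ X' with hBdef
  have hC := hT₁.mix hB h₀ (inter hX hX')
  set C := T₁ ∩ (X ∩ X') ∪ B \ (X ∩ X') with hCdef
  have hAe : Q.Spans A e := hs₁.mono (by grind) (hA.insert h₀ he)
  have hBx : Q.Spans B x := hs₄.mono (by grind) (hB.insert h₀ hx)
  -- Varying `B` inside `X ∩ X'` never spans `e`: the `Y`-side is that of `B`, and an `X`-side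
  -- spanning `e` would be compatible with `T₂ ∩ Y'`, which spans `x`.
  have hCx : Q.Spans C x := by
    refine htight.spans_of_sdiff_eq h₀ (inter hX hX') hB hC (by grind) hx he ?_ hBx
    intro R hR hRB hRe
    rcases h.spans_inter_or h₀ he hR hRe with hs | hs
    · have hD := hR.mix hT₂ h₀ hX
      refine hnot hD (hs.mono (by grind) (hD.insert h₀ he)) (hs₂.mono ?_ (hD.insert h₀ hx))
      intro a ha
      have h1 : a ∈ R \ (X ∩ X') ↔ a ∈ B \ (X ∩ X') := by rw [hRB]
      have h2 := @hdXY' a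
      grind
    · have : R ∩ Y = B ∩ Y := by
        ext a
        have h1 : a ∈ R \ (X ∩ X') ↔ a ∈ B \ (X ∩ X') := by rw [hRB]
        have h2 := @hdXY a
        grind
      exact hnot hB (spans_of_spans_inter h₀ he hB (this ▸ hs)) hBx
  -- Symmetrically, varying `A` inside `X ∩ Y'` never spans `x`.
  have hCe : Q.Spans C e := by
    refine htight.spans_of_sdiff_eq h₀ (inter hX hY') hA hC ?_ he hx ?_ hAe
    · ext a
      have h1 := @hdXY' a
      have h2 := h'.mem_or_mem h₀ hT₁ (x := a)
      have h3 := h'.mem_or_mem h₀ hT₂ (x := a)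
      grind
    intro R hR hRA hRx
    rcases h'.spans_inter_or h₀ hx hR hRx with hs | hs
    · have : R ∩ X' = A ∩ X' := by
        ext a
        have h1 : a ∈ R \ (X ∩ Y') ↔ a ∈ A \ (X ∩ Y') := by rw [hRA]
        have h2 := @hdXY' a
        grind
      exact hnot hA hAe (spans_of_spans_inter h₀ hx hA (this ▸ hs))
    · have hD := hR.mix hT₃ h₀ hY'
      refine hnot hD (hs₃.mono ?_ (hD.insert h₀ he)) (hs.mono (by grind) (hD.insert h₀ hx))
      intro a ha
      have h1 : a ∈ R \ (X ∩ Y') ↔ a ∈ A \ (X ∩ Y') := by rw [hRA]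
      have h2 := @hdXY a
      have h3 := @hdXY' a
      have h4 := h'.mem_or_mem h₀ hT₃ (x := a)
      grind
  exact hnot hC hCe hCx

end IsSplit

/-! ### Passing between minors and separations -/

/-- A disconnected minor `Q|e` gives a separation. -/
theorem exists_isSplit {ω₀ : Finset α} {e : α} (h₀ : ω₀ ∈ Q.classes.parts) (he : e ∈ ω₀)
    (hsub : IsSubtransversal Q.classes {e}) (h : ¬ (Q.minor {e} hsub).Connected) :
    ∃ X Y, Q.IsSplit ω₀ e X Y := by
  obtain ⟨X, ⟨⟨P, hP, hPX⟩, hr⟩, hne, hneq⟩ := not_not.1 h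
  have hP' : ∀ ω ∈ P, ω ∈ Q.classes.parts ∧ e ∉ ω := by
    intro ω hω
    simpa using mem_classesAvoiding.1 (hP hω)
  have hground : ∀ {a}, a ∈ (Q.minor {e} hsub).ground ↔ ∃ ω ∈ Q.classes.parts, e ∉ ω ∧ a ∈ ω := by
    intro a
    simpa using mem_minor_ground hsub (a := a)
  have hX : ∀ {a}, a ∈ X ↔ ∃ ω ∈ P, a ∈ ω := by
    intro a
    simp [hPX]
  have hXg : X ⊆ (Q.minor {e} hsub).ground := fun a ha => by
    obtain ⟨ω, hω, haω⟩ := hX.1 ha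
    exact hground.2 ⟨ω, (hP' ω hω).1, (hP' ω hω).2, haω⟩
  have hgQ : (Q.minor {e} hsub).ground ⊆ Q.ground := fun a ha => by
    obtain ⟨ω, hω, -, haω⟩ := hground.1 ha
    exact Q.classes.le hω haω
  have hd : Disjoint ω₀ (Q.minor {e} hsub).ground := by
    rw [Finset.disjoint_left]
    intro a ha hag
    obtain ⟨ω, hω, heω, haω⟩ := hground.1 hag
    exact heω (Q.classes.eq_of_mem_parts h₀ hω ha haω ▸ he)
  refine ⟨X, (Q.minor {e} hsub).ground \ X, hne, ?_, hXg.trans hgQ,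
    Finset.sdiff_subset.trans hgQ, Finset.disjoint_sdiff, hd.mono_right hXg,
    hd.mono_right Finset.sdiff_subset, ?_, ?_⟩
  · exact Finset.sdiff_nonempty.2 fun hs => hneq (hXg.antisymm hs)
  · intro ω hω hne₀
    have heω : e ∉ ω := fun h => hne₀ (Q.classes.eq_of_mem_parts hω h₀ h he)
    by_cases hωP : ω ∈ P
    · exact .inl fun a ha => hX.2 ⟨ω, hωP, ha⟩
    · refine .inr fun a ha => Finset.mem_sdiff.2 ⟨hground.2 ⟨ω, hω, heω, ha⟩, fun haX => ?_⟩
      obtain ⟨η, hη, haη⟩ := hX.1 haX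
      exact hωP (Q.classes.eq_of_mem_parts hω (hP' η hη).1 ha haη ▸ hη)
  · intro T hT heT
    have hK : IsSubtransversal (classesAvoiding Q.classes {e}) (T.erase e) := by
      refine isSubtransversal_classesAvoiding_iff.2 ⟨hT.mono (Finset.erase_subset _ _), ?_⟩
      intro ω hω heω
      rw [Finset.disjoint_singleton_right, not_not] at heω
      rw [Finset.disjoint_left]
      intro a ha haT
      exact (Finset.mem_erase.1 haT).1 (hT.eq_of_mem hω (Finset.mem_erase.1 haT).2 heT ha heω)
    have h1 := minor_r_add hsub hK
    have h2 := minor_r_add hsub (hK.mono (Finset.inter_subset_left (s₂ := X)))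
    have h3 := minor_r_add hsub (hK.mono (Finset.sdiff_subset (t := X)))
    have h4 := hr _ hK
    have heX : e ∉ X := fun h => by
      obtain ⟨ω, hω, h⟩ := hX.1 h
      exact (hP' ω hω).2 h
    have e1 : T.erase e ∪ {e} = T := by grind
    have e2 : T.erase e ∩ X ∪ {e} = insert e (T ∩ X) := by grind
    have e3 : T.erase e \ X ∪ {e} = insert e (T ∩ ((Q.minor {e} hsub).ground \ X)) := by
      ext a
      have : a ∈ T.erase e → a ∈ (Q.minor {e} hsub).ground := fun h => hK.subset h
      simp only [Finset.mem_union, Finset.mem_sdiff, Finset.mem_erase, Finset.mem_singleton,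
        Finset.mem_insert, Finset.mem_inter] at this ⊢
      tauto
    rw [e1] at h1
    rw [e2] at h2
    rw [e3] at h3
    omega

theorem ext_of_parts {P R : Multimatroid α} (hparts : P.classes.parts = R.classes.parts)
    (hr : ∀ K, IsSubtransversal P.classes K → P.r K = R.r K) : P = R := by
  obtain ⟨U, Ω, r, hP, _, _, _, _⟩ := P
  obtain ⟨V, Θ, s, hR, _, _, _, _⟩ := R
  have hUV : U = V := by
    rw [← Ω.sup_parts, ← Θ.sup_parts]
    exact congrArg (fun p => Finset.sup p id) hparts
  subst hUV
  obtain rfl : Ω = Θ := Finpartition.ext hparts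
  have hrs : r = s := by
    funext K
    by_cases hK : IsSubtransversal Ω K
    · exact hr K hK
    · rw [hP K hK, hR K hK]
  subst hrs
  rfl

/-- If `Q|A` is connected, `e ∈ A`, and `X`, `Y` separate `Q|e`, then `A` meets all classes on one
of the two sides. -/
theorem IsSplit.meets_or_meets {ω₀ X Y A : Finset α} {e : α} (h : Q.IsSplit ω₀ e X Y)
    (he : e ∈ ω₀) (hA : IsSubtransversal Q.classes A) (heA : e ∈ A)
    (hAconn : (Q.minor A hA).Connected) :
    (∀ ω ∈ Q.classes.parts, ω ⊆ X → ¬ Disjoint ω A) ∨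
      ∀ ω ∈ Q.classes.parts, ω ⊆ Y → ¬ Disjoint ω A := by
  by_contra! hcon
  obtain ⟨⟨ω₁, hω₁, hω₁X, hd₁⟩, ω₂, hω₂, hω₂Y, hd₂⟩ := hcon
  have hXY : ∀ a, a ∈ X → a ∉ Y := fun _ ha => Finset.disjoint_left.1 h.disjoint ha
  set P := Q.classes.parts.filter fun ω => Disjoint ω A ∧ ω ⊆ X with hP
  have hmemP : ∀ {a}, a ∈ P.biUnion id ↔
      ∃ ω ∈ Q.classes.parts, (Disjoint ω A ∧ ω ⊆ X) ∧ a ∈ ω := by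
    intro a
    simp [hP, and_assoc]
  refine hAconn ⟨P.biUnion id, ⟨⟨P, ?_, rfl⟩, ?_⟩, ?_, ?_⟩
  · intro ω hω
    rw [hP, Finset.mem_filter] at hω
    exact mem_classesAvoiding.2 ⟨hω.1, hω.2.1⟩
  · intro K hK
    have hKA := hA.union_of_avoiding hK
    have hKside : ∀ a ∈ K, (a ∈ P.biUnion id ↔ a ∈ X) ∧ (a ∉ P.biUnion id ↔ a ∈ Y) := by
      intro a ha
      obtain ⟨ω, hω, hd, haω⟩ := (mem_minor_ground hA).1 (hK.subset ha)
      have hne : ω ≠ ω₀ := by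
        rintro rfl
        exact Finset.disjoint_left.1 hd he heA
      have h1 := hXY a
      rw [hmemP]
      rcases h.subset_or_subset ω hω hne with hs | hs
      · have h2 : a ∈ X := hs haω
        have h3 : ∃ ω ∈ Q.classes.parts, (Disjoint ω A ∧ ω ⊆ X) ∧ a ∈ ω :=
          ⟨ω, hω, ⟨hd, hs⟩, haω⟩
        exact ⟨iff_of_true h3 h2, iff_of_false (not_not_intro h3) (h1 h2)⟩
      · have h2 : a ∈ Y := hs haω
        have h3 : ¬ ∃ ω ∈ Q.classes.parts, (Disjoint ω A ∧ ω ⊆ X) ∧ a ∈ ω := by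
          rintro ⟨η, hη, ⟨-, hηX⟩, haη⟩
          exact h1 (hηX haη) h2
        exact ⟨iff_of_false h3 fun h => h1 h h2, iff_of_true h3 h2⟩
    have e1 : K ∩ P.biUnion id = K ∩ X := by
      ext a
      have := hKside a
      simp only [Finset.mem_inter]
      tauto
    have e2 : K \ P.biUnion id = K ∩ Y := by
      ext a
      have := hKside a
      simp only [Finset.mem_inter, Finset.mem_sdiff]
      tauto
    rw [e1, e2]
    have hKX := hK.mono (Finset.inter_subset_left (s₂ := X))
    have hKY := hK.mono (Finset.inter_subset_left (s₂ := Y))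
    have m1 := minor_r_add hA hK
    have m2 := minor_r_add hA hKX
    have m3 := minor_r_add hA hKY
    have r1 := h.rank _ hKA (Finset.mem_union_right _ heA)
    have r2 := h.rank _ (hA.union_of_avoiding hKX) (Finset.mem_union_right _ heA)
    have r3 := h.rank _ (hA.union_of_avoiding hKY) (Finset.mem_union_right _ heA)
    have r4 := h.rank _ hA heA
    have s1 : (K ∩ X ∪ A) ∩ X = (K ∪ A) ∩ X := by grind
    have s2 : (K ∩ X ∪ A) ∩ Y = A ∩ Y := by
      ext a
      have := hXY a
      simp only [Finset.mem_inter, Finset.mem_union]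
      tauto
    have s3 : (K ∩ Y ∪ A) ∩ X = A ∩ X := by
      ext a
      have := hXY a
      simp only [Finset.mem_inter, Finset.mem_union]
      tauto
    have s4 : (K ∩ Y ∪ A) ∩ Y = (K ∪ A) ∩ Y := by grind
    rw [s1, s2] at r2
    rw [s3, s4] at r3
    omega
  · obtain ⟨a, ha⟩ := Q.classes.nonempty_of_mem_parts hω₁
    exact ⟨a, hmemP.2 ⟨ω₁, hω₁, ⟨hd₁, hω₁X⟩, ha⟩⟩
  · intro heq
    obtain ⟨a, ha⟩ := Q.classes.nonempty_of_mem_parts hω₂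
    have : a ∈ P.biUnion id := heq ▸ (mem_minor_ground hA).2 ⟨ω₂, hω₂, hd₂, ha⟩
    obtain ⟨ω, -, ⟨-, hωX⟩, haω⟩ := hmemP.1 this
    exact hXY a (hωX haω) (hω₂Y ha)

theorem IsSplit.isSubtransversal_union {ω₀ X Y L M : Finset α} {e : α}
    (h : Q.IsSplit ω₀ e X Y) (hL : IsSubtransversal Q.classes L)
    (hM : IsSubtransversal Q.classes M) (hLY : L ⊆ Y) (hMX : M ⊆ X) :
    IsSubtransversal Q.classes (L ∪ M) := by
  have mixed : ∀ ω ∈ Q.classes.parts, ∀ a ∈ L, ∀ b ∈ M, a ∈ ω → b ∈ ω → False := by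
    intro ω hω a ha b hb haω hbω
    have hs := (h.subset_or_disjoint ω hω (h.ne_of_mem hbω (hMX hb))).resolve_right
      fun hd => Finset.disjoint_left.1 hd hbω (hMX hb)
    exact Finset.disjoint_left.1 h.disjoint (hs haω) (hLY ha)
  refine isSubtransversal_iff_forall_mem.2 ⟨Finset.union_subset hL.subset hM.subset, ?_⟩
  intro ω hω a ha b hb haω hbω
  rcases Finset.mem_union.1 ha with ha | ha <;> rcases Finset.mem_union.1 hb with hb | hb
  · exact hL.eq_of_mem hω ha hb haω hbω
  · exact (mixed ω hω a ha b hb haω hbω).elim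
  · exact (mixed ω hω b hb a ha hbω haω).elim
  · exact hM.eq_of_mem hω ha hb haω hbω

/-! ### Recovering `Q|A` as a minor of `Q|x` -/

/-- If `T ∩ X` spans `e`, then the minors `Q|(x ∪ (T ∩ X))` and `Q|e` agree on `Y`: together
with the case `L = ∅` this says that they give `L` the same rank. -/
theorem IsSplit.rank_insert_union {ω₀ X Y T L : Finset α} {e x : α} (h : Q.IsSplit ω₀ e X Y)
    (h₀ : ω₀ ∈ Q.classes.parts) (he : e ∈ ω₀) (hx : x ∈ ω₀) (hex : e ≠ x)
    (hT : IsTransversalOff Q.classes ω₀ T) (hspan : Q.Spans (T ∩ X) e) (hLY : L ⊆ Y)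
    (hL : IsSubtransversal Q.classes L) :
    Q.r (insert x (L ∪ T ∩ X)) + Q.r {e} =
      Q.r (insert e L) + Q.r (insert e (T ∩ X)) + 1 := by
  have hXY : ∀ a, a ∈ X → a ∉ Y := fun _ ha => Finset.disjoint_left.1 h.disjoint ha
  have hsub : IsSubtransversal Q.classes (L ∪ T ∩ X) :=
    h.isSubtransversal_union hL (hT.1.mono Finset.inter_subset_left) hLY
      Finset.inter_subset_right
  have hd : Disjoint ω₀ (L ∪ T ∩ X) := by
    rw [Finset.disjoint_union_right]
    exact ⟨h.disjoint_right.mono_right hLY, h.disjoint_left.mono_right Finset.inter_subset_right⟩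
  have hinse := hsub.insert h₀ hd he
  have hse : Q.Spans (L ∪ T ∩ X) e := hspan.mono Finset.subset_union_right hinse
  have h1 := r_insert_of_not_spans (hsub.insert h₀ hd hx) fun hsx =>
    hex (hse.unique hsx hsub h₀ hd he hx)
  have h2 := h.rank _ hinse (Finset.mem_insert_self _ _)
  have heX := Finset.disjoint_left.1 h.disjoint_left he
  have heY := Finset.disjoint_left.1 h.disjoint_right he
  have e1 : insert e (L ∪ T ∩ X) ∩ X = T ∩ X := by
    ext a
    have h3 := hXY a
    have h4 := @hLY a
    have h5 : a = e → a ∉ X := fun h => h ▸ heX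
    simp only [Finset.mem_inter, Finset.mem_insert, Finset.mem_union]
    tauto
  have e2 : insert e (L ∪ T ∩ X) ∩ Y = L := by
    ext a
    have h3 := hXY a
    have h4 := @hLY a
    have h5 : a = e → a ∉ Y := fun h => h ▸ heY
    simp only [Finset.mem_inter, Finset.mem_insert, Finset.mem_union]
    tauto
  rw [e1, e2] at h2
  unfold Spans at hse
  omega

/-- If `A` meets all classes in `X`, then `Q|A` is obtained from `Q|x` by exchanging the part of
`A` in `X` for a transversal that spans `e`. -/
theorem IsSplit.isMinor {ω₀ X Y A : Finset α} {e x : α} (h : Q.IsSplit ω₀ e X Y)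
    (hconn : Q.Connected) (htight : Q.Tight) (h₀ : ω₀ ∈ Q.classes.parts) (he : e ∈ ω₀)
    (hx : x ∈ ω₀) (hex : e ≠ x) (hxsub : IsSubtransversal Q.classes {x})
    (hA : IsSubtransversal Q.classes A) (heA : e ∈ A)
    (hmeet : ∀ ω ∈ Q.classes.parts, ω ⊆ X → ¬ Disjoint ω A) :
    (Q.minor A hA).IsMinor (Q.minor {x} hxsub) := by
  obtain ⟨T, hT, hspan⟩ := h.exists_spans_inter hconn htight h₀ he
  have hXY : ∀ a, a ∈ X → a ∉ Y := fun _ ha => Finset.disjoint_left.1 h.disjoint ha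
  -- Disjointness from `x` and from the new set amounts to disjointness from `A`.
  have hdisj : ∀ ω ∈ Q.classes.parts,
      Disjoint ω A ↔ Disjoint ω {x} ∧ Disjoint ω (A ∩ Y ∪ T ∩ X) := by
    intro ω hω
    rcases eq_or_ne ω ω₀ with rfl | hne
    · refine iff_of_false (fun hd => Finset.disjoint_left.1 hd he heA) fun hd => ?_
      exact Finset.disjoint_left.1 hd.1 hx (Finset.mem_singleton_self x)
    have hxω : Disjoint ω {x} := Finset.disjoint_singleton_right.2 fun hxω =>
      hne (Q.classes.eq_of_mem_parts hω h₀ hxω hx)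
    rcases h.subset_or_subset ω hω hne with hs | hs
    · refine iff_of_false (hmeet ω hω hs) fun hd => ?_
      obtain ⟨a, haω, haT⟩ := hT.exists_mem hω hne
      exact Finset.disjoint_left.1 hd.2 haω
        (Finset.mem_union_right _ (Finset.mem_inter.2 ⟨haT, hs haω⟩))
    · rw [and_iff_right hxω, Finset.disjoint_left, Finset.disjoint_left]
      refine forall₂_congr fun a ha => ?_
      have h1 := hs ha
      have h2 := hXY a
      simp only [Finset.mem_inter, Finset.mem_union]
      tauto
  have hsub : IsSubtransversal Q.classes (A ∩ Y ∪ T ∩ X) :=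
    h.isSubtransversal_union (hA.mono Finset.inter_subset_left)
      (hT.1.mono Finset.inter_subset_left) Finset.inter_subset_right Finset.inter_subset_right
  have hsub' : IsSubtransversal (classesAvoiding Q.classes {x}) (A ∩ Y ∪ T ∩ X) := by
    refine isSubtransversal_classesAvoiding_iff.2 ⟨hsub, fun ω hω hxω => ?_⟩
    rw [Finset.disjoint_singleton_right, not_not] at hxω
    obtain rfl := Q.classes.eq_of_mem_parts hω h₀ hxω hx
    rw [Finset.disjoint_union_right]
    exact ⟨h.disjoint_right.mono_right Finset.inter_subset_right,
      h.disjoint_left.mono_right Finset.inter_subset_right⟩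
  refine ⟨A ∩ Y ∪ T ∩ X, hsub', ext_of_parts ?_ fun K hK => ?_⟩
  · ext ω
    change ω ∈ (classesAvoiding _ _).parts ↔ ω ∈ (classesAvoiding (classesAvoiding _ _) _).parts
    rw [mem_classesAvoiding, mem_classesAvoiding, mem_classesAvoiding, and_assoc]
    exact and_congr_right fun hω => hdisj ω hω
  have hKQ := isSubtransversal_classesAvoiding_iff.1 hK
  have hK₁ : IsSubtransversal (classesAvoiding Q.classes {x}) K :=
    isSubtransversal_classesAvoiding_iff.2 ⟨hKQ.1, fun ω hω hd => hKQ.2 ω hω fun hdA =>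
      hd ((hdisj ω hω).1 hdA).1⟩
  have hK₂ : IsSubtransversal (classesAvoiding (classesAvoiding Q.classes {x})
      (A ∩ Y ∪ T ∩ X)) K :=
    isSubtransversal_classesAvoiding_iff.2 ⟨hK₁, fun ω hω hd =>
      have hω := (mem_classesAvoiding.1 hω).1
      hKQ.2 ω hω fun hdA => hd ((hdisj ω hω).1 hdA).2⟩
  have hKY : K ⊆ Y := by
    intro a ha
    obtain ⟨ω, hω, hd, haω⟩ := (mem_minor_ground hA).1 (hK.subset ha)
    have hne : ω ≠ ω₀ := by
      rintro rfl
      exact Finset.disjoint_left.1 hd he heA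
    exact (h.subset_or_subset ω hω hne).resolve_left (fun hs => hmeet ω hω hs hd) haω
  have hKA := hA.union_of_avoiding hK
  have m1 := minor_r_add hA hK
  have m2 := minor_r_add (Q := Q.minor {x} hxsub) hsub' hK₂
  have m3 := minor_r_add hxsub hsub'
  have m4 := minor_r_add hxsub (IsSubtransversal.union_of_avoiding hsub' hK₂)
  have s1 := h.rank_insert_union h₀ he hx hex hT hspan (L := A ∩ Y) Finset.inter_subset_right
    (hA.mono Finset.inter_subset_left)
  have s2 := h.rank_insert_union h₀ he hx hex hT hspan (L := K ∪ A ∩ Y)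
    (Finset.union_subset hKY Finset.inter_subset_right)
    (hKA.mono (Finset.union_subset_union_right Finset.inter_subset_left))
  have r1 := h.rank A hA heA
  have r2 := h.rank _ hKA (Finset.mem_union_right _ heA)
  have e1 : (K ∪ A) ∩ X = A ∩ X := by
    ext a
    have h1 := hXY a
    have h2 := @hKY a
    simp only [Finset.mem_inter, Finset.mem_union]
    tauto
  have e2 : (K ∪ A) ∩ Y = K ∪ A ∩ Y := by
    rw [Finset.union_inter_distrib_right, Finset.inter_eq_left.2 hKY]
  rw [e1, e2] at r2
  rw [Finset.union_comm _ {x}, ← Finset.insert_eq] at m3 m4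
  rw [Finset.union_assoc] at s2
  omega

end Multimatroid

theorem theorem2p4 {α : Type*} [DecidableEq α] (Q : Multimatroid α)
    (hconn : Q.Connected) (htight : Q.Tight)
    (A : Finset α) (hA : IsSubtransversal Q.classes A) (hne : A.Nonempty)
    (hAconn : (Q.minor A hA).Connected)
    (e : α) (he : e ∈ A) :
    (Q.minor {e} (hA.singleton_of_mem he)).Connected ∨
      ∀ (x : α) (hx : IsSkewPair Q.classes e x),
        (Q.minor {x} hx.right_singleton).Connected ∧
          (Q.minor A hA).IsMinor (Q.minor {x} hx.right_singleton) := by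
  refine or_iff_not_imp_left.2 fun hdis x hx => ?_
  obtain ⟨hex, ω₀, h₀, he₀, hx₀⟩ := id hx
  obtain ⟨X, Y, h⟩ := Multimatroid.exists_isSplit h₀ he₀ _ hdis
  refine ⟨?_, ?_⟩
  · by_contra hdis'
    obtain ⟨X', Y', h'⟩ := Multimatroid.exists_isSplit h₀ hx₀ _ hdis'
    exact hex (h.eq_of_isSplit h' hconn htight h₀ he₀ hx₀)
  · rcases h.meets_or_meets he₀ hA he hAconn with hm | hm
    · exact h.isMinor hconn htight h₀ he₀ hx₀ hex _ hA he hm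
    · exact h.symm.isMinor hconn htight h₀ he₀ hx₀ hex _ hA he hm
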